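/- **Setting.** Let $d\ge 2$, let $(S_k)_{k\ge0}$ be the simple random walk on $\mathbb Z^d$, with law $P^z$ and expectation $E^z$ when started at $z$, and let $\mathbb P$ be the product measure on $\Omega=[0,\infty)^{\mathbb Z^d}$ under which the potentials $\omega(z)$, $z\in\mathbb Z^d$, are i.i.d. with a given law. Fix $\kappa>0$ with $\mathbb P(\omega(0)\ge\kappa)>0$. Call a set $A$ *occupied* in $\omega$ if $\omega(z)\ge\kappa$ for some $z\in A\cap\mathbb Z^d$. For $x\in\mathbb Z^d$ let $H(x)=\inf\{k\ge0: S_k=x\}$, $$e(0,x)=e(0,x,\omega)=E^0\Bigl[\exp\Bigl\{-\sum_{k=0}^{H(x)-1}\omega(S_k)\Bigr\}\mathbf 1_{\{H(x)<\infty\}}\Bigr],$$ let $Q_\omega^{0,x}$ be the probability measure with $$\frac{dQ_\omega^{0,x}}{dP^0}=e(0,x,\omega)^{-1}\exp\Bigl\{-\sum_{k=0}^{H(x)-1}\omega(S_k)\Bigr\}\mathbf 1_{\{H(x)<\infty\}},$$ let $\hat E_\omega^{0,x}$ be the expectation under $Q_\omega^{0,x}$, and let $\mathcal A=\{S_k: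 0\le k<H(x)\}$. For an even positive integer $l$ let $\tau_1=\inf\{k>0:\|S_k-S_0\|_\infty\ge 3l/4\}$ and $$\chi=\sup\Bigl\{E^z\Bigl[\exp\Bigl\{-\sum_{k=0}^{\tau_1-1}\omega(S_k)\Bigr\}\Bigr] : z\in\mathbb Z^d,\ \|z\|_\infty\le l/2,\ \omega\in\Omega,\ (-l/8,l/8)^d\text{ is occupied in }\omega\Bigr\}.$$ **Proposition.** For all sufficiently large even $l$ the following hold. 1. $\chi\in(0,1)$. 2. There exist constants $C_1,C_2,C_3,C_4\in(0,\infty)$ and events $A_n\subset\Omega$, $n=0,1,2,\dots$, such that for every $n$ one has $\mathbb P(A_n^c)\le C_1e^{-C_2n}$ and, for every $\omega\in A_n$ and every $x\in\mathbb Z^d$, $$\hat E_\omega^{0,x}\bigl[\exp\{C_3\,\#\mathcal A\}\bigr]\le C_4\,\chi^{-n}\,e(0,x,\omega)^{-1}.$$ -/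

import Mathlib

open MeasureTheory ProbabilityTheory
open scoped NNReal ENNReal

namespace RandomPotential

/-- The lattice `ℤ^d`. Its norm `‖·‖` in Mathlib is the sup-norm. -/
abbrev Lattice (d : ℕ) : Type := Fin d → ℤ

/-- Nearest-neighbour trajectories are points of the space of all sequences of lattice sites. -/
abbrev Path (d : ℕ) : Type := ℕ → Lattice d

/-- The space `[0,∞)^{ℤ^d}` of potentials, with its product σ-field. -/
abbrev Potential (d : ℕ) : Type := Lattice d → ℝ≥0

/-- The law of the i.i.d. potential whose one-site marginal is `μ`. -/
noncomputable def potentialLaw (d : ℕ) (μ : Measure ℝ≥0) [IsProbabilityMeasure μ] :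
    Measure (Potential d) :=
  Measure.infinitePi fun _ : Lattice d => μ

section Walk

variable {d : ℕ}

/-- The law of one step of the simple random walk: uniform on the `2d` vectors `± e_i`. -/
noncomputable def stepLaw (d : ℕ) [NeZero d] : Measure (Lattice d) :=
  ((PMF.uniformOfFintype (Fin d × ℤˣ)).map
    fun p => (Pi.single p.1 (p.2 : ℤ) : Lattice d)).toMeasure

instance (d : ℕ) [NeZero d] : IsProbabilityMeasure (stepLaw d) := by
  unfold stepLaw; infer_instance

/-- The path started at `z` with increments `ξ`. -/
def pathOfSteps (z : Lattice d) (ξ : ℕ → Lattice d) : Path d :=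
  fun k => z + ∑ j ∈ Finset.range k, ξ j

theorem measurable_pathOfSteps (z : Lattice d) : Measurable (pathOfSteps z) := by
  unfold pathOfSteps
  fun_prop

/-- The law `P^z` of the simple random walk on `ℤ^d` started at `z`. -/
noncomputable def walkLaw [NeZero d] (z : Lattice d) : Measure (Path d) :=
  (Measure.infinitePi fun _ : ℕ => stepLaw d).map (pathOfSteps z)

instance [NeZero d] (z : Lattice d) : IsProbabilityMeasure (walkLaw z) :=
  Measure.isProbabilityMeasure_map (measurable_pathOfSteps z).aemeasurable

/-- The first time `k ≥ 0` at which the path is at `y` (`⊤` if there is none). -/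
noncomputable def hitTime (y : Lattice d) (S : Path d) : ℕ∞ :=
  sInf {t : ℕ∞ | ∃ k : ℕ, t = k ∧ S k = y}

/-- The time `τ₁`: the first `k > 0` at which the path is at sup-distance at least `3l/4` from its
starting point (`⊤` if there is none, an event of `walkLaw z`-probability zero). -/
noncomputable def crossTime (l : ℕ) (S : Path d) : ℕ∞ :=
  sInf {t : ℕ∞ | ∃ k : ℕ, t = k ∧ 0 < k ∧ 3 * (l : ℝ) / 4 ≤ ‖S k - S 0‖}

/-- `exp(-∑_{k<t} ω(S_k))` for a finite time `t`; only used for times `t` that are finite or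
almost surely finite. -/
noncomputable def killing (ω : Potential d) (t : ℕ∞) (S : Path d) : ℝ :=
  Real.exp (-∑ k ∈ Finset.range t.toNat, (ω (S k) : ℝ))

/-- `exp(-∑_{k<H(y)} ω(S_k)) 1{H(y) < ∞}`. -/
noncomputable def hitWeight (ω : Potential d) (y : Lattice d) : Path d → ℝ :=
  {S | hitTime y S < ⊤}.indicator fun S => killing ω (hitTime y S) S

/-- `e(x,y,ω) = E^x[exp(-∑_{k<H(y)} ω(S_k)) 1{H(y) < ∞}]`. -/
noncomputable def travel [NeZero d] (ω : Potential d) (x y : Lattice d) : ℝ :=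
  ∫ S, hitWeight ω y S ∂(walkLaw x)

/-- The weighted path measure `Q_ω^{0,x}`, with density
`e(0,x,ω)⁻¹ exp(-∑_{k<H(x)} ω(S_k)) 1{H(x) < ∞}` with respect to `P^0`. -/
noncomputable def weightedLaw [NeZero d] (ω : Potential d) (x : Lattice d) : Measure (Path d) :=
  (walkLaw (0 : Lattice d)).withDensity
    fun S => ENNReal.ofReal ((travel ω 0 x)⁻¹ * hitWeight ω x S)

/-- `𝒜 = {S_k : 0 ≤ k < H(x)}`. It is a finite set whenever `H(x) < ∞`, hence
`weightedLaw ω x`-almost surely. -/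
def rangeBefore (x : Lattice d) (S : Path d) : Set (Lattice d) :=
  {z | ∃ k : ℕ, (k : ℕ∞) < hitTime x S ∧ S k = z}

/-- A set of sites is occupied if it contains a site where the potential is at least `κ`. -/
def Occupied (κ : ℝ) (ω : Potential d) (A : Set (Lattice d)) : Prop :=
  ∃ z ∈ A, κ ≤ (ω z : ℝ)

/-- The lattice sites of the open cube `(-l/8, l/8)^d`. -/
def innerCube (d l : ℕ) : Set (Lattice d) :=
  {z | ∀ i, -(l : ℝ) / 8 < (z i : ℝ) ∧ (z i : ℝ) < (l : ℝ) / 8}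

/-- `χ`: the supremum of `E^z[exp(-∑_{k<τ₁} ω(S_k))]` over all sites `z` with `‖z‖_∞ ≤ l/2` and all
potentials `ω` for which `(-l/8, l/8)^d` is occupied. -/
noncomputable def chi (d : ℕ) [NeZero d] (κ : ℝ) (l : ℕ) : ℝ :=
  sSup {r : ℝ | ∃ (z : Lattice d) (ω : Potential d),
    ‖z‖ ≤ (l : ℝ) / 2 ∧ Occupied κ ω (innerCube d l) ∧
      r = ∫ S, killing ω (crossTime l S) S ∂(walkLaw z)}

end Walk

end RandomPotential

/-! The lattice is coarse-grained into boxes of side `l`, and a path is cut each time it gets to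
distance `3l/4` from the previous cut point. The boxes containing the cut points form a lattice
animal `D`. Every site visited lies within `2l` of the centre of some box of `D`, so the range has
at most `(4l+1)^d * #D` sites.

A Peierls argument (`exists_good_events`) controls the environment: outside an event of probability
exponentially small in `n`, every animal with more than `n` boxes has more than half of its boxes
occupied, so `#D ≤ n + 2 * #occ(D)`. An exponential moment of the range is thus bounded by a factor
for the `n` free boxes, absorbed in `χ⁻¹ ^ n`, and a factor `G` for each distinct occupied box.

A crossing begun in an occupied box has mean weight at most `χ` (`truncMean_le_chi`), and `χ < 1`
because a prescribed path of bounded length visits an occupied site before the exit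
(`integral_killing_le`). For small `c` one has `G * χ < 1`, so the killing pays for `G`. This is
made precise by a supermartingale bound (`truncMean_le_of_supermartingale`) with potential function
`G ^ #occ(D) * (1 + β * u)`, where `u` is the mean weight up to the end of the current crossing. It
bounds the unnormalised moment by `G * (1 + β) * χ⁻¹ ^ n`; dividing by `e(0,x)` gives the claim. -/

namespace RandomPotential

section

/-! ### First times -/

/-- The first time at which `P` holds (`⊤` if there is none). -/
noncomputable def firstTime (P : ℕ → Prop) : ℕ∞ := sInf {t : ℕ∞ | ∃ k : ℕ, t = k ∧ P k}

theorem firstTime_eq_coe {P : ℕ → Prop} {k : ℕ} (hk : P k) (hj : ∀ j < k, ¬ P j) :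
    firstTime P = k := by
  refine le_antisymm (sInf_le ⟨k, rfl, hk⟩) (le_sInf ?_)
  rintro _ ⟨j, rfl, h⟩
  exact_mod_cast not_lt.1 fun hlt => hj j hlt h

theorem firstTime_eq_top {P : ℕ → Prop} (h : ∀ k, ¬ P k) : firstTime P = ⊤ := by
  refine sInf_eq_top.2 ?_
  rintro _ ⟨k, -, hk⟩
  exact absurd hk (h k)

theorem exists_first {P : ℕ → Prop} (h : ∃ k, P k) : ∃ k, P k ∧ ∀ j < k, ¬ P j := by
  classical
  exact ⟨Nat.find h, Nat.find_spec h, fun j hj => Nat.find_min h hj⟩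

theorem exists_first_of_firstTime_lt_top {P : ℕ → Prop} (h : firstTime P < ⊤) :
    ∃ k, P k ∧ ∀ j < k, ¬ P j := by
  refine exists_first ?_
  by_contra! hP
  exact h.ne (firstTime_eq_top hP)

/-- The second alternative is the default value: `toNat` sends `⊤` to `0`. -/
theorem firstTime_toNat_eq_iff {P : ℕ → Prop} {k : ℕ} :
    (firstTime P).toNat = k ↔ (P k ∧ ∀ j < k, ¬ P j) ∨ (k = 0 ∧ ∀ j, ¬ P j) := by
  constructor
  · rintro rfl
    by_cases h : ∃ k, P k
    · obtain ⟨k, hk, hj⟩ := exists_first h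
      rw [firstTime_eq_coe hk hj]
      exact Or.inl ⟨hk, hj⟩
    · push Not at h
      rw [firstTime_eq_top h]
      exact Or.inr ⟨rfl, h⟩
  · rintro (⟨hk, hj⟩ | ⟨rfl, h⟩)
    · rw [firstTime_eq_coe hk hj]; rfl
    · rw [firstTime_eq_top h]; rfl

theorem measurable_firstTime_toNat {Ω : Type*} [MeasurableSpace Ω] {P : ℕ → Ω → Prop}
    (hP : ∀ k, MeasurableSet {S | P k S}) :
    Measurable fun S => (firstTime fun k => P k S).toNat := by
  refine measurable_to_countable' fun k => ?_
  have : (fun S => (firstTime fun k => P k S).toNat) ⁻¹' {k} =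
      ({S | P k S} ∩ ⋂ j, ⋂ (_ : j < k), {S | P j S}ᶜ) ∪
        ({_S | k = 0} ∩ ⋂ j, {S | P j S}ᶜ) := by
    ext S
    simp [firstTime_toNat_eq_iff]
  rw [this]
  exact ((hP k).inter (.iInter fun j => .iInter fun _ => (hP j).compl)).union
    ((MeasurableSet.const _).inter (.iInter fun j => (hP j).compl))

theorem measurableSet_firstTime_lt_top {Ω : Type*} [MeasurableSpace Ω] {P : ℕ → Ω → Prop}
    (hP : ∀ k, MeasurableSet {S | P k S}) :
    MeasurableSet {S | (firstTime fun k => P k S) < ⊤} := by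
  have : {S | (firstTime fun k => P k S) < ⊤} = ⋃ k, {S | P k S} := by
    ext S
    simp only [Set.mem_ofPred_eq, Set.mem_iUnion]
    refine ⟨fun h => (exists_first_of_firstTime_lt_top h).imp fun _ h => h.1, fun h => ?_⟩
    obtain ⟨k, hk, hj⟩ := exists_first h
    rw [firstTime_eq_coe hk hj]
    exact ENat.natCast_lt_top k
  rw [this]
  exact .iUnion hP

variable {d : ℕ}

theorem measurable_killing_firstTime (ω : Potential d) {P : ℕ → Path d → Prop}
    (hP : ∀ k, MeasurableSet {S | P k S}) :
    Measurable fun S => killing ω (firstTime fun k => P k S) S := by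
  unfold killing
  have key : Measurable fun q : ℕ × Path d =>
      Real.exp (-∑ k ∈ Finset.range q.1, (ω (q.2 k) : ℝ)) := by
    refine measurable_from_prod_countable_right fun n => ?_
    refine Real.measurable_exp.comp (Measurable.neg ?_)
    refine Finset.measurable_sum (Finset.range n) fun k _ => ?_
    exact (Measurable.of_discrete (f := fun v : Lattice d => (ω v : ℝ))).comp
      (measurable_pi_apply k)
  exact key.comp ((measurable_firstTime_toNat hP).prodMk measurable_id)

theorem crossTime_eq_firstTime (l : ℕ) (S : Path d) :
    crossTime l S = firstTime fun k => 0 < k ∧ 3 * (l : ℝ) / 4 ≤ ‖S k - S 0‖ := rfl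

theorem hitTime_eq_firstTime (y : Lattice d) (S : Path d) :
    hitTime y S = firstTime fun k => S k = y := rfl

theorem measurable_killing_crossTime (ω : Potential d) (l : ℕ) :
    Measurable fun S => killing ω (crossTime l S) S := by
  simp only [crossTime_eq_firstTime]
  refine measurable_killing_firstTime ω
    (P := fun k S => 0 < k ∧ 3 * (l : ℝ) / 4 ≤ ‖S k - S 0‖) fun k => ?_
  have h : Measurable fun S : Path d => (S k, S 0) :=
    (measurable_pi_apply k).prodMk (measurable_pi_apply 0)
  exact (MeasurableSet.const _).inter
    (h (MeasurableSet.of_discrete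
      (s := {v : Lattice d × Lattice d | 3 * (l : ℝ) / 4 ≤ ‖v.1 - v.2‖})))

theorem measurable_hitWeight (ω : Potential d) (y : Lattice d) : Measurable (hitWeight ω y) := by
  have hP : ∀ k, MeasurableSet {S : Path d | S k = y} := fun k =>
    (measurable_pi_apply (X := fun _ : ℕ => Lattice d) k) (measurableSet_singleton y)
  unfold hitWeight
  simp only [hitTime_eq_firstTime]
  exact (measurable_killing_firstTime ω (P := fun k S => S k = y) hP).indicator
    (measurableSet_firstTime_lt_top (P := fun k (S : Path d) => S k = y) hP)

theorem killing_nonneg (ω : Potential d) (t : ℕ∞) (S : Path d) : 0 ≤ killing ω t S :=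
  (Real.exp_pos _).le

theorem killing_le_one (ω : Potential d) (t : ℕ∞) (S : Path d) : killing ω t S ≤ 1 :=
  Real.exp_le_one_iff.2 (neg_nonpos.2 (Finset.sum_nonneg fun _ _ => NNReal.coe_nonneg _))

/-! ### Steps -/

/-- The sequence with first term `s` and tail `ξ`. -/
def consSeq (p : Lattice d × (ℕ → Lattice d)) : ℕ → Lattice d
  | 0 => p.1
  | k + 1 => p.2 k

theorem measurable_consSeq : Measurable (consSeq (d := d)) := by
  refine measurable_pi_lambda _ fun k => ?_
  cases k with
  | zero => exact measurable_fst
  | succ k => exact (measurable_pi_apply k).comp measurable_snd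

theorem pathOfSteps_zero (z : Lattice d) (ξ : ℕ → Lattice d) : pathOfSteps z ξ 0 = z := by
  simp [pathOfSteps]

theorem pathOfSteps_consSeq_succ (z s : Lattice d) (ξ : ℕ → Lattice d) (k : ℕ) :
    pathOfSteps z (consSeq (s, ξ)) (k + 1) = pathOfSteps (z + s) ξ k := by
  simp only [pathOfSteps, Finset.sum_range_succ', consSeq]
  abel

theorem pathOfSteps_succ' (z : Lattice d) (ξ : ℕ → Lattice d) (k : ℕ) :
    pathOfSteps z ξ (k + 1) = pathOfSteps (z + ξ 0) (fun j => ξ (j + 1)) k := by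
  simp only [pathOfSteps, Finset.sum_range_succ']
  abel

theorem pathOfSteps_add (z v : Lattice d) (ξ : ℕ → Lattice d) (k : ℕ) :
    pathOfSteps (z + v) ξ k = pathOfSteps z ξ k + v := by
  simp only [pathOfSteps]
  abel

variable [NeZero d]

/-- The law of the sequence of steps of the walk. -/
noncomputable def stepsLaw (d : ℕ) [NeZero d] : Measure (ℕ → Lattice d) :=
  Measure.infinitePi fun _ : ℕ => stepLaw d

instance : IsProbabilityMeasure (stepsLaw d) := by unfold stepsLaw; infer_instance

/-- This is the Markov property at time one. An infinite product measure is determined by its values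
on cylinders, and a cylinder splits into a condition on the first step and one on the shifted
sequence. -/
theorem map_consSeq : ((stepLaw d).prod (stepsLaw d)).map consSeq = stepsLaw d := by
  refine Measure.eq_infinitePi _ fun s t ht => ?_
  rw [Measure.map_apply measurable_consSeq (.pi s.countable_toSet fun i _ => ht i)]
  -- Padding with `univ` turns the index set `s` into an initial segment, which can be shifted.
  set t' : ℕ → Set (Lattice d) := fun i => if i ∈ s then t i else Set.univ with ht'
  have ht'm : ∀ i, MeasurableSet (t' i) := fun i => by
    simp only [ht']; split_ifs; exacts [ht i, .univ]
  obtain ⟨N, hN⟩ : ∃ N, s ⊆ Finset.range (N + 1) :=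
    ⟨s.sup id, fun i hi => Finset.mem_range.2 (Nat.lt_succ_of_le (Finset.le_sup (f := id) hi))⟩
  have hset : consSeq ⁻¹' Set.pi (s : Set ℕ) t =
      t' 0 ×ˢ Set.pi (Finset.range N : Set ℕ) fun i => t' (i + 1) := by
    ext ⟨a, ξ⟩
    simp only [Set.mem_preimage, Set.mem_pi, Set.mem_prod, Finset.mem_coe, ht']
    constructor
    · intro h
      refine ⟨?_, fun i _ => ?_⟩
      · split_ifs with h0
        exacts [h 0 h0, trivial]
      · split_ifs with h0
        exacts [h (i + 1) h0, trivial]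
    · rintro ⟨h0, h1⟩ i hi
      cases i with
      | zero => simpa [hi, consSeq] using h0
      | succ i =>
        have := h1 i (by have := hN hi; simp at this ⊢; omega)
        simpa [hi, consSeq] using this
  rw [hset, Measure.prod_prod, stepsLaw, Measure.infinitePi_pi _ (fun i _ => ht'm _),
    mul_comm, ← Finset.prod_range_succ' (fun i => stepLaw d (t' i))]
  rw [← Finset.prod_subset hN]
  · exact Finset.prod_congr rfl fun i hi => by simp [ht', hi]
  · intro i _ hi
    simp [ht', hi]

theorem lintegral_stepsLaw {f : (ℕ → Lattice d) → ℝ≥0∞} (hf : Measurable f) :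
    ∫⁻ ξ, f ξ ∂stepsLaw d = ∫⁻ s, ∫⁻ ξ, f (consSeq (s, ξ)) ∂stepsLaw d ∂stepLaw d := by
  conv_lhs => rw [← map_consSeq]
  rw [lintegral_map hf measurable_consSeq,
    lintegral_prod (fun p => f (consSeq p)) (hf.comp measurable_consSeq).aemeasurable]


theorem mem_support_map_uniform_iff {s : Lattice d} :
    s ∈ ((PMF.uniformOfFintype (Fin d × ℤˣ)).map
      fun p => (Pi.single p.1 (p.2 : ℤ) : Lattice d)).support ↔
      ∃ (i : Fin d) (ε : ℤˣ), Pi.single i (ε : ℤ) = s := by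
  simp [PMF.support_map]

theorem ae_stepLaw_abs_le_one : ∀ᵐ s ∂stepLaw d, ∀ i, |s i| ≤ 1 := by
  rw [ae_iff, stepLaw, PMF.toMeasure_apply_eq_zero_iff _ (MeasurableSet.of_discrete)]
  rw [Set.disjoint_left]
  intro s hs hs'
  obtain ⟨i, ε, rfl⟩ := mem_support_map_uniform_iff.1 hs
  refine hs' fun j => ?_
  by_cases h : j = i
  · subst h
    rcases Int.units_eq_one_or ε with rfl | rfl <;> simp
  · simp [h]

theorem inv_two_mul_le_stepLaw (i : Fin d) (ε : ℤˣ) :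
    ((2 * d : ℕ) : ℝ≥0∞)⁻¹ ≤ stepLaw d {Pi.single i (ε : ℤ)} := by
  rw [stepLaw, PMF.toMeasure_apply_singleton _ _ (measurableSet_singleton _), PMF.map_apply]
  refine le_trans ?_ (ENNReal.le_tsum (i, ε))
  simp [mul_comm]

end

section

variable {d : ℕ}

/-! ### Path weights up to the hitting time of a set -/

open Classical in
/-- The weight `h(B ∪ {S_0, …, S_{H-1}}) exp(-∑_{k<H} ω(S_k)) 1{H ≤ N}`, where `S` is the path from
`z` with steps `ξ` and `H` is its hitting time of `T`. -/
noncomputable def truncWeight (ω : Potential d) (T : Set (Lattice d))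
    (h : Finset (Lattice d) → ℝ≥0∞) :
    ℕ → Finset (Lattice d) → Lattice d → (ℕ → Lattice d) → ℝ≥0∞
  | 0, B, z, _ => if z ∈ T then h B else 0
  | N + 1, B, z, ξ => if z ∈ T then h B else
      ENNReal.ofReal (Real.exp (-(ω z : ℝ))) *
        truncWeight ω T h N (insert z B) (z + ξ 0) fun k => ξ (k + 1)

open Classical in
/-- The expectation of `truncWeight`. -/
noncomputable def truncMean [NeZero d] (ω : Potential d) (T : Set (Lattice d))
    (h : Finset (Lattice d) → ℝ≥0∞) : ℕ → Finset (Lattice d) → Lattice d → ℝ≥0∞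
  | 0, B, z => if z ∈ T then h B else 0
  | N + 1, B, z => if z ∈ T then h B else
      ENNReal.ofReal (Real.exp (-(ω z : ℝ))) *
        ∫⁻ s, truncMean ω T h N (insert z B) (z + s) ∂stepLaw d

variable {ω : Potential d} {T : Set (Lattice d)} {h : Finset (Lattice d) → ℝ≥0∞}

theorem ofReal_exp_neg_le_one (t : ℝ≥0) : ENNReal.ofReal (Real.exp (-(t : ℝ))) ≤ 1 :=
  ENNReal.ofReal_le_one.2 (Real.exp_le_one_iff.2 (neg_nonpos.2 t.2))

theorem truncWeight_of_mem {N : ℕ} {B : Finset (Lattice d)} {z : Lattice d} (hz : z ∈ T)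
    (ξ : ℕ → Lattice d) : truncWeight ω T h N B z ξ = h B := by
  cases N <;> simp [truncWeight, hz]

theorem truncWeight_succ_of_notMem {N : ℕ} {B : Finset (Lattice d)} {z : Lattice d} (hz : z ∉ T)
    (ξ : ℕ → Lattice d) : truncWeight ω T h (N + 1) B z ξ =
      ENNReal.ofReal (Real.exp (-(ω z : ℝ))) *
        truncWeight ω T h N (insert z B) (z + ξ 0) fun k => ξ (k + 1) := by
  simp [truncWeight, hz]

theorem measurable_truncWeight (N : ℕ) (B : Finset (Lattice d)) (z : Lattice d) :
    Measurable (truncWeight ω T h N B z) := by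
  induction N generalizing B z with
  | zero => exact measurable_const
  | succ N ih =>
    by_cases hz : z ∈ T
    · rw [show truncWeight ω T h (N + 1) B z = fun _ => h B from
        funext fun ξ => truncWeight_of_mem hz ξ]
      exact measurable_const
    · rw [show truncWeight ω T h (N + 1) B z = _ from
        funext fun ξ => truncWeight_succ_of_notMem hz ξ]
      refine Measurable.const_mul ?_ _
      have hp : Measurable fun q : Lattice d × (ℕ → Lattice d) =>
          truncWeight ω T h N (insert z B) q.1 q.2 :=
        measurable_from_prod_countable_right fun y => ih _ y
      refine hp.comp (Measurable.prodMk ?_ ?_)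
      · exact (Measurable.of_discrete (f := fun v : Lattice d => z + v)).comp
          (measurable_pi_apply 0)
      · exact measurable_pi_lambda _ fun k => measurable_pi_apply (k + 1)

theorem truncWeight_le_succ (N : ℕ) (B : Finset (Lattice d)) (z : Lattice d)
    (ξ : ℕ → Lattice d) : truncWeight ω T h N B z ξ ≤ truncWeight ω T h (N + 1) B z ξ := by
  induction N generalizing B z ξ with
  | zero =>
    by_cases hz : z ∈ T
    · simp [truncWeight_of_mem hz]
    · simp [truncWeight, hz]
  | succ N ih =>
    by_cases hz : z ∈ T
    · simp [truncWeight_of_mem hz]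
    · rw [truncWeight_succ_of_notMem hz, truncWeight_succ_of_notMem hz]
      gcongr
      exact ih _ _ _

/-- The recursion removes one step at a time, so it collects one visited site and one factor
`exp(-ω)` for each time before the hit. -/
theorem truncWeight_of_first {N k : ℕ} {B : Finset (Lattice d)} {z : Lattice d}
    {ξ : ℕ → Lattice d} (hkN : k ≤ N) (hk : pathOfSteps z ξ k ∈ T)
    (hj : ∀ j < k, pathOfSteps z ξ j ∉ T) :
    truncWeight ω T h N B z ξ = h (B ∪ (Finset.range k).image (pathOfSteps z ξ)) *
      ENNReal.ofReal (killing ω k (pathOfSteps z ξ)) := by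
  induction k generalizing N B z ξ with
  | zero =>
    rw [pathOfSteps_zero] at hk
    simp [truncWeight_of_mem hk, killing]
  | succ k ih =>
    obtain ⟨N, rfl⟩ : ∃ M, N = M + 1 := ⟨N - 1, by omega⟩
    have hz : z ∉ T := by simpa [pathOfSteps_zero] using hj 0 k.succ_pos
    rw [truncWeight_succ_of_notMem hz, ih (by omega) (by rwa [← pathOfSteps_succ'])
      (fun j hjk => by rw [← pathOfSteps_succ']; exact hj (j + 1) (by omega))]
    have hset : B ∪ (Finset.range (k + 1)).image (pathOfSteps z ξ) = insert z B ∪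
        (Finset.range k).image (pathOfSteps (z + ξ 0) fun j => ξ (j + 1)) := by
      ext v
      simp only [Finset.mem_union, Finset.mem_image, Finset.mem_range, Finset.mem_insert]
      constructor
      · rintro (hv | ⟨j, hjk, rfl⟩)
        · exact Or.inl (Or.inr hv)
        · cases j with
          | zero => exact Or.inl (Or.inl (pathOfSteps_zero z ξ))
          | succ j => exact Or.inr ⟨j, by omega, (pathOfSteps_succ' z ξ j).symm⟩
      · rintro ((rfl | hv) | ⟨j, hjk, rfl⟩)
        · exact Or.inr ⟨0, by omega, pathOfSteps_zero v ξ⟩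
        · exact Or.inl hv
        · exact Or.inr ⟨j + 1, by omega, pathOfSteps_succ' z ξ j⟩
    rw [hset, mul_left_comm, ← ENNReal.ofReal_mul (Real.exp_pos _).le]
    congr 2
    simp only [killing, ENat.toNat_natCast, ← Real.exp_add, Finset.sum_range_succ',
      pathOfSteps_zero, pathOfSteps_succ']
    congr 1
    ring

theorem truncWeight_of_forall_notMem {N : ℕ} {B : Finset (Lattice d)} {z : Lattice d}
    {ξ : ℕ → Lattice d} (hj : ∀ j, pathOfSteps z ξ j ∉ T) :
    truncWeight ω T h N B z ξ = 0 := by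
  induction N generalizing B z ξ with
  | zero =>
    have hz : z ∉ T := by simpa [pathOfSteps_zero] using hj 0
    simp [truncWeight, hz]
  | succ N ih =>
    have hz : z ∉ T := by simpa [pathOfSteps_zero] using hj 0
    rw [truncWeight_succ_of_notMem hz, ih, mul_zero]
    intro j
    rw [← pathOfSteps_succ']
    exact hj (j + 1)

theorem truncWeight_one_le {N : ℕ} {B : Finset (Lattice d)} {z : Lattice d}
    {ξ : ℕ → Lattice d} : truncWeight ω T 1 N B z ξ ≤
      ENNReal.ofReal (killing ω (firstTime fun k => pathOfSteps z ξ k ∈ T) (pathOfSteps z ξ)) := by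
  by_cases hT : ∃ k, pathOfSteps z ξ k ∈ T
  · obtain ⟨k, hk, hj⟩ := exists_first hT
    rw [firstTime_eq_coe hk hj]
    -- The horizon `N` may precede the hitting time `k`, so it is first enlarged by monotonicity.
    calc truncWeight ω T 1 N B z ξ ≤ truncWeight ω T 1 (max N k) B z ξ :=
          monotone_nat_of_le_succ (f := fun N => truncWeight ω T 1 N B z ξ)
            (fun N => truncWeight_le_succ N B z ξ) (le_max_left _ _)
      _ = _ := by rw [truncWeight_of_first (le_max_right _ _) hk hj]; simp
  · rw [truncWeight_of_forall_notMem (by simpa using hT)]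
    exact zero_le

variable [NeZero d]

theorem truncMean_of_mem {N : ℕ} {B : Finset (Lattice d)} {z : Lattice d} (hz : z ∈ T) :
    truncMean ω T h N B z = h B := by
  cases N <;> simp [truncMean, hz]

theorem truncMean_succ_of_notMem {N : ℕ} {B : Finset (Lattice d)} {z : Lattice d} (hz : z ∉ T) :
    truncMean ω T h (N + 1) B z = ENNReal.ofReal (Real.exp (-(ω z : ℝ))) *
      ∫⁻ s, truncMean ω T h N (insert z B) (z + s) ∂stepLaw d := by
  simp [truncMean, hz]

/-- This ties the path functional to a recursion on sites alone, so that later estimates are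
inductions on `N` without stopping times or conditioning. -/
theorem lintegral_truncWeight (N : ℕ) (B : Finset (Lattice d)) (z : Lattice d) :
    ∫⁻ ξ, truncWeight ω T h N B z ξ ∂stepsLaw d = truncMean ω T h N B z := by
  induction N generalizing B z with
  | zero => simp [truncWeight, truncMean]
  | succ N ih =>
    by_cases hz : z ∈ T
    · simp [truncWeight_of_mem hz, truncMean_of_mem hz]
    · rw [lintegral_stepsLaw (measurable_truncWeight _ _ _), truncMean_succ_of_notMem hz]
      simp only [truncWeight_succ_of_notMem hz, consSeq]
      rw [← lintegral_const_mul' _ _ ENNReal.ofReal_ne_top]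
      refine lintegral_congr fun s => ?_
      rw [lintegral_const_mul' _ _ ENNReal.ofReal_ne_top, ih]

theorem truncMean_one_le_one (N : ℕ) (B : Finset (Lattice d)) (z : Lattice d) :
    truncMean ω T 1 N B z ≤ 1 := by
  induction N generalizing B z with
  | zero => by_cases hz : z ∈ T <;> simp [truncMean, hz]
  | succ N ih =>
    by_cases hz : z ∈ T
    · simp [truncMean_of_mem hz]
    · rw [truncMean_succ_of_notMem hz]
      refine mul_le_one' (ofReal_exp_neg_le_one _) ?_
      calc _ ≤ ∫⁻ _s, 1 ∂stepLaw d := lintegral_mono fun s => ih _ _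
        _ = 1 := by simp

/-- With constant reward the record of visited sites is irrelevant and can be reset. -/
theorem truncMean_one_congr (N : ℕ) (B B' : Finset (Lattice d)) (z : Lattice d) :
    truncMean ω T 1 N B z = truncMean ω T 1 N B' z := by
  induction N generalizing B B' z with
  | zero => simp [truncMean]
  | succ N ih =>
    by_cases hz : z ∈ T
    · simp [truncMean_of_mem hz]
    · rw [truncMean_succ_of_notMem hz, truncMean_succ_of_notMem hz]
      congr 1
      exact lintegral_congr fun s => ih _ _ _

theorem truncMean_one_le (N : ℕ) (B : Finset (Lattice d)) (z : Lattice d) :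
    truncMean ω T 1 N B z ≤ ∫⁻ ξ, ENNReal.ofReal
      (killing ω (firstTime fun k => pathOfSteps z ξ k ∈ T) (pathOfSteps z ξ)) ∂stepsLaw d := by
  rw [← lintegral_truncWeight]
  exact lintegral_mono fun ξ => truncWeight_one_le

/-- If the truncated means are bounded by `K`, so is the integral of a functional of the path that
is dominated by the weight up to the hitting time. -/
theorem lintegral_le_of_truncMean_le {K : ℝ≥0∞} {z : Lattice d} {f : (ℕ → Lattice d) → ℝ≥0∞}
    (hK : ∀ N, truncMean ω T h N ∅ z ≤ K)
    (hf : ∀ ξ k, pathOfSteps z ξ k ∈ T → (∀ j < k, pathOfSteps z ξ j ∉ T) →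
      f ξ ≤ h ((Finset.range k).image (pathOfSteps z ξ)) *
        ENNReal.ofReal (killing ω k (pathOfSteps z ξ)))
    (hf' : ∀ ξ, (∀ j, pathOfSteps z ξ j ∉ T) → f ξ = 0) :
    ∫⁻ ξ, f ξ ∂stepsLaw d ≤ K := by
  calc ∫⁻ ξ, f ξ ∂stepsLaw d ≤ ∫⁻ ξ, ⨆ N, truncWeight ω T h N ∅ z ξ ∂stepsLaw d := by
        refine lintegral_mono fun ξ => ?_
        by_cases hT : ∃ k, pathOfSteps z ξ k ∈ T
        · obtain ⟨k, hk, hj⟩ := exists_first hT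
          refine le_trans (hf ξ k hk hj) (le_trans (le_of_eq ?_) (le_iSup _ k))
          rw [truncWeight_of_first le_rfl hk hj, Finset.empty_union]
        · simp [hf' ξ (by simpa using hT)]
    _ = ⨆ N, ∫⁻ ξ, truncWeight ω T h N ∅ z ξ ∂stepsLaw d :=
        lintegral_iSup (fun N => measurable_truncWeight N ∅ z)
          (monotone_nat_of_le_succ fun N ξ => truncWeight_le_succ N ∅ z ξ)
    _ ≤ K := iSup_le fun N => by rw [lintegral_truncWeight]; exact hK N

end

section

variable {d : ℕ}

/-! ### Lattice animals -/

/-- The vectors of sup-norm at most two. -/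
noncomputable def shortVectors (d : ℕ) : Finset (Lattice d) := Finset.Icc (fun _ => -2) (fun _ => 2)

theorem mem_shortVectors {e : Lattice d} : e ∈ shortVectors d ↔ ∀ i, |e i| ≤ 2 := by
  simp only [shortVectors, Finset.mem_Icc, Pi.le_def, abs_le, forall_and]

theorem neg_mem_shortVectors {e : Lattice d} (he : e ∈ shortVectors d) : -e ∈ shortVectors d := by
  simpa [mem_shortVectors] using he

/-- Finite sets of sites that contain the origin and are connected by steps of sup-norm at most
two. -/
inductive IsAnimal : Finset (Lattice d) → Prop
  | single : IsAnimal {0}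
  | insert {D : Finset (Lattice d)} {y e : Lattice d} (hD : IsAnimal D) (hy : y ∈ D)
      (he : e ∈ shortVectors d) : IsAnimal (insert (y + e) D)

/-- The sites visited by the path from `z` with the given list of steps. -/
def visits : Lattice d → List (Lattice d) → Finset (Lattice d)
  | z, [] => {z}
  | z, e :: L => insert z (visits (z + e) L)

theorem self_mem_visits (z : Lattice d) (L : List (Lattice d)) : z ∈ visits z L := by
  cases L <;> simp [visits]

/-- A detour `y → y + e → y` inserted at an occurrence of `y` costs two steps and adds one site.
Growing an animal site by site this way encodes `K` sites by `2(K-1)` steps, which makes the number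
of animals exponential in `K`. -/
theorem exists_visits_eq_insert {y e : Lattice d} (he : e ∈ shortVectors d)
    (L : List (Lattice d)) (z : Lattice d) (hL : ∀ s ∈ L, s ∈ shortVectors d)
    (hy : y ∈ visits z L) :
    ∃ L' : List (Lattice d), L'.length = L.length + 2 ∧ (∀ s ∈ L', s ∈ shortVectors d) ∧
      visits z L' = insert (y + e) (visits z L) := by
  by_cases hyz : y = z
  · subst hyz
    refine ⟨e :: -e :: L, by simp, ?_, ?_⟩
    · simpa using ⟨he, neg_mem_shortVectors he, hL⟩
    · simp only [visits, add_neg_cancel_right]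
      rw [Finset.insert_comm, Finset.insert_eq_of_mem (self_mem_visits y L)]
  induction L generalizing z with
  | nil => exact absurd (by simpa [visits] using hy) hyz
  | cons s L ih =>
    have hy' : y ∈ visits (z + s) L := by simpa [visits, hyz] using hy
    have hs := hL s (by simp)
    have hL' : ∀ s ∈ L, s ∈ shortVectors d := fun t ht => hL t (by simp [ht])
    suffices h : ∃ L' : List (Lattice d), L'.length = L.length + 2 ∧
        (∀ s ∈ L', s ∈ shortVectors d) ∧
        visits (z + s) L' = insert (y + e) (visits (z + s) L) by
      obtain ⟨L', h1, h2, h3⟩ := h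
      refine ⟨s :: L', by simp [h1], by simpa using ⟨hs, h2⟩, ?_⟩
      simp only [visits, h3]
      rw [Finset.insert_comm]
    by_cases h : y = z + s
    · subst h
      refine ⟨e :: -e :: L, by simp, by simpa using ⟨he, neg_mem_shortVectors he, hL'⟩, ?_⟩
      simp only [visits, add_neg_cancel_right]
      rw [Finset.insert_comm, Finset.insert_eq_of_mem (self_mem_visits _ L)]
    · exact ih (z + s) hL' hy' h

theorem IsAnimal.exists_visits {D : Finset (Lattice d)} (hD : IsAnimal D) :
    ∃ L : List (Lattice d), L.length = 2 * (D.card - 1) ∧ (∀ s ∈ L, s ∈ shortVectors d) ∧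
      visits 0 L = D := by
  induction hD with
  | single => exact ⟨[], by simp [visits]⟩
  | @insert D y e hD hy he ih =>
    obtain ⟨L, h1, h2, h3⟩ := ih
    by_cases hmem : y + e ∈ D
    · rw [Finset.insert_eq_of_mem hmem]
      exact ⟨L, h1, h2, h3⟩
    · obtain ⟨L', h1', h2', h3'⟩ := exists_visits_eq_insert he L 0 h2 (h3 ▸ hy)
      refine ⟨L', ?_, h2', by rw [h3', h3]⟩
      rw [h1', h1, Finset.card_insert_of_notMem hmem]
      have := Finset.card_pos.2 ⟨y, hy⟩
      omega

/-- A finite family of sets containing every animal with `K` sites. -/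
noncomputable def animals (d K : ℕ) : Finset (Finset (Lattice d)) :=
  ((Finset.univ : Finset (Fin (2 * (K - 1)) → shortVectors d)).image
    fun v => visits 0 (List.ofFn fun i => (v i : Lattice d))).filter fun D => D.card = K

theorem IsAnimal.mem_animals {D : Finset (Lattice d)} (hD : IsAnimal D) :
    D ∈ animals d D.card := by
  obtain ⟨L, h1, h2, h3⟩ := hD.exists_visits
  refine Finset.mem_filter.2 ⟨Finset.mem_image.2
    ⟨fun i => ⟨L.get (i.cast h1.symm), h2 _ (List.get_mem _ _)⟩, Finset.mem_univ _, ?_⟩, rfl⟩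
  refine (congrArg (visits 0) ?_).trans h3
  exact List.ext_get (by simp [h1]) fun n _ _ => by simp

theorem card_of_mem_animals {K : ℕ} {D : Finset (Lattice d)} (hD : D ∈ animals d K) :
    D.card = K := (Finset.mem_filter.1 hD).2

theorem zero_mem_shortVectors : (0 : Lattice d) ∈ shortVectors d := by simp [mem_shortVectors]

theorem card_animals_le (K : ℕ) : (animals d K).card ≤ ((shortVectors d).card ^ 2) ^ K := by
  calc (animals d K).card ≤ (shortVectors d).card ^ (2 * (K - 1)) := by
        refine (Finset.card_filter_le _ _).trans (Finset.card_image_le.trans ?_)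
        simp
    _ ≤ (shortVectors d).card ^ (2 * K) :=
        Nat.pow_le_pow_right (Finset.card_pos.2 ⟨0, zero_mem_shortVectors⟩) (by omega)
    _ = _ := by rw [pow_mul]

/-! ### Most boxes of a large animal are occupied -/

variable [NeZero d]

/-- The site at distance `j` from the centre `l • y` of the box `y`, in the first direction. -/
def boxSite (l : ℕ) (y : Lattice d) (j : ℕ) : Lattice d :=
  (l : ℤ) • y + Pi.single 0 (j : ℤ)

/-- The first coordinate modulo `l` recovers `j`. Segments of distinct boxes are therefore disjoint,
which makes their vacancies independent. -/
theorem boxSite_injOn {l M : ℕ} (hM : M ≤ l) {y y' : Lattice d} {j j' : ℕ} (hj : j < M)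
    (hj' : j' < M) (h : boxSite l y j = boxSite l y' j') : y = y' ∧ j = j' := by
  have h0 : (l : ℤ) * y 0 + j = l * y' 0 + j' := by simpa [boxSite] using congrFun h 0
  have hjj : (j : ℤ) = j' := by
    have := congrArg (· % (l : ℤ)) h0
    simp only [Int.mul_add_emod_self_left] at this
    rwa [Int.emod_eq_of_lt (by omega) (by omega), Int.emod_eq_of_lt (by omega) (by omega)] at this
  have hjj' : j = j' := by exact_mod_cast hjj
  subst hjj'
  refine ⟨?_, rfl⟩
  have h1 := add_right_cancel h
  exact smul_right_injective _ (show (l : ℤ) ≠ 0 by omega) h1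

/-- The box `y` is occupied at one of the first `M` sites of the half-line from its centre. -/
def LineOccupied (κ : ℝ) (M l : ℕ) (ω : Potential d) (y : Lattice d) : Prop :=
  ∃ j < M, κ ≤ (ω (boxSite l y j) : ℝ)

/-- No box of `Y` is occupied. -/
def vacantEvent (κ : ℝ) (M l : ℕ) (Y : Finset (Lattice d)) : Set (Potential d) :=
  {ω | ∀ y ∈ Y, ¬ LineOccupied κ M l ω y}

theorem vacantEvent_eq_pi (κ : ℝ) (M l : ℕ) (Y : Finset (Lattice d)) :
    vacantEvent κ M l Y = Set.pi
      (((Y ×ˢ Finset.range M).image fun p => boxSite l p.1 p.2 : Finset (Lattice d)) :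
        Set (Lattice d)) fun _ => {t : ℝ≥0 | κ ≤ (t : ℝ)}ᶜ := by
  ext ω
  simp only [vacantEvent, LineOccupied, Set.mem_ofPred_eq, Set.mem_pi, Finset.mem_coe,
    Finset.mem_image, Finset.mem_product, Finset.mem_range, Prod.exists, Set.mem_compl_iff]
  constructor
  · rintro h _ ⟨y, j, ⟨hy, hj⟩, rfl⟩ hκ
    exact h y hy ⟨j, hj, hκ⟩
  · rintro h y hy ⟨j, hj, hκ⟩
    exact h _ ⟨y, j, ⟨hy, hj⟩, rfl⟩ hκ

theorem measurableSet_level (κ : ℝ) : MeasurableSet {t : ℝ≥0 | κ ≤ (t : ℝ)} :=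
  measurableSet_le measurable_const measurable_coe_nnreal_real

theorem measurableSet_vacantEvent (κ : ℝ) (M l : ℕ) (Y : Finset (Lattice d)) :
    MeasurableSet (vacantEvent κ M l Y) := by
  rw [vacantEvent_eq_pi]
  exact .pi (Finset.countable_toSet _) fun _ _ => (measurableSet_level κ).compl

theorem potentialLaw_vacantEvent (μ : Measure ℝ≥0) [IsProbabilityMeasure μ] (κ : ℝ) {M l : ℕ}
    (hM : M ≤ l) (Y : Finset (Lattice d)) :
    potentialLaw d μ (vacantEvent κ M l Y) = (μ {t : ℝ≥0 | κ ≤ (t : ℝ)}ᶜ ^ M) ^ Y.card := by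
  rw [vacantEvent_eq_pi, potentialLaw,
    Measure.infinitePi_pi _ (fun _ _ => (measurableSet_level κ).compl), Finset.prod_const,
    Finset.card_image_of_injOn, Finset.card_product, Finset.card_range, ← pow_mul, mul_comm]
  rintro ⟨y, j⟩ h ⟨y', j'⟩ h' heq
  simp only [Finset.coe_product, Set.mem_prod, Finset.mem_coe, Finset.mem_range] at h h'
  obtain ⟨rfl, rfl⟩ := boxSite_injOn hM h.2 h'.2 heq
  rfl

/-- At least half of the boxes of some animal with `K` sites are vacant. -/
def sparseEvent (κ : ℝ) (M l K : ℕ) : Set (Potential d) :=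
  ⋃ D ∈ animals d K, ⋃ Y ∈ D.powerset.filter fun Y => K ≤ 2 * Y.card, vacantEvent κ M l Y

theorem measurableSet_sparseEvent (κ : ℝ) (M l K : ℕ) :
    MeasurableSet (sparseEvent (d := d) κ M l K) :=
  Finset.measurableSet_biUnion _ fun _ _ => Finset.measurableSet_biUnion _ fun _ _ =>
    measurableSet_vacantEvent _ _ _ _

/-- Union bound: at most `(#shortVectors ^ 2) ^ K` animals, at most `2 ^ K` choices of vacant boxes
in each, and probability at most `r ^ K` for each choice, since at least `K / 2` boxes are vacant at
cost `r ^ 2` each. -/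
theorem potentialLaw_sparseEvent_le (μ : Measure ℝ≥0) [IsProbabilityMeasure μ] (κ : ℝ) {M l : ℕ}
    (hM : M ≤ l) (K : ℕ) {r : ℝ≥0∞} (hr : r ≤ 1)
    (hq : μ {t : ℝ≥0 | κ ≤ (t : ℝ)}ᶜ ^ M ≤ r ^ 2) :
    potentialLaw d μ (sparseEvent κ M l K) ≤ (((shortVectors d).card : ℝ≥0∞) ^ 2 * (2 * r)) ^ K := by
  calc potentialLaw d μ (sparseEvent κ M l K)
      ≤ ∑ D ∈ animals d K, ∑ Y ∈ D.powerset.filter fun Y => K ≤ 2 * Y.card,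
          potentialLaw d μ (vacantEvent κ M l Y) := by
        refine (measure_biUnion_finset_le _ _).trans (Finset.sum_le_sum fun D _ => ?_)
        exact measure_biUnion_finset_le _ _
    _ ≤ ∑ D ∈ animals d K, ∑ _Y ∈ D.powerset, r ^ K := by
        refine Finset.sum_le_sum fun D _ => ?_
        refine (Finset.sum_le_sum fun Y hY => ?_).trans
          (Finset.sum_le_sum_of_subset (Finset.filter_subset _ _))
        rw [potentialLaw_vacantEvent μ κ hM]
        calc _ ≤ (r ^ 2) ^ Y.card := by gcongr
          _ = r ^ (2 * Y.card) := by rw [pow_mul]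
          _ ≤ r ^ K := pow_le_pow_right_of_le_one' hr (Finset.mem_filter.1 hY).2
    _ = (animals d K).card * (2 * r) ^ K := by
        rw [Finset.sum_congr rfl (g := fun _ => (2 * r) ^ K), Finset.sum_const, nsmul_eq_mul]
        intro D hD
        rw [Finset.sum_const, Finset.card_powerset, card_of_mem_animals hD, nsmul_eq_mul, mul_pow]
        simp
    _ ≤ _ := by
        rw [mul_pow _ (2 * r)]
        gcongr
        exact_mod_cast card_animals_le (d := d) K

theorem exists_good_events (d : ℕ) [NeZero d] (μ : Measure ℝ≥0) [IsProbabilityMeasure μ] (κ : ℝ)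
    (hocc : 0 < μ {t : ℝ≥0 | κ ≤ (t : ℝ)}) :
    ∃ M : ℕ, ∀ l : ℕ, M ≤ l → ∃ A : ℕ → Set (Potential d), ∀ n : ℕ,
      MeasurableSet (A n) ∧
      potentialLaw d μ (A n)ᶜ ≤ ENNReal.ofReal (2 * Real.exp (-Real.log 2 * n)) ∧
      ∀ ω ∈ A n, ∀ D : Finset (Lattice d), IsAnimal D →
        ∀ Y ⊆ D, (∀ y ∈ Y, ¬ LineOccupied κ M l ω y) → D.card ≤ n ∨ 2 * Y.card < D.card := by
  set N : ℝ≥0∞ := ((shortVectors d).card : ℝ≥0∞) with hN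
  have hN1 : 1 ≤ N := by
    rw [hN]
    exact_mod_cast Finset.card_pos.2 ⟨0, zero_mem_shortVectors⟩
  have hNtop : N ≠ ⊤ := ENNReal.natCast_ne_top _
  -- Chosen so that the base of the union bound, `N ^ 2 * (2 * r)`, equals `1/2`.
  set r : ℝ≥0∞ := (N ^ 2 * 4)⁻¹ with hr
  have hr1 : r ≤ 1 := by
    rw [hr, ENNReal.inv_le_one]
    exact one_le_mul (one_le_pow_of_one_le' hN1 2) (by norm_num)
  have hden : N ^ 2 * 4 ≠ ⊤ := ENNReal.mul_ne_top (ENNReal.pow_ne_top hNtop) (by norm_num)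
  have hr0 : 0 < r ^ 2 := pos_of_ne_zero (pow_ne_zero 2 (ENNReal.inv_ne_zero.2 hden))
  have hNr : N ^ 2 * (2 * r) = 2⁻¹ := by
    have h1 : N ^ 2 * 4 * r = 1 := ENNReal.mul_inv_cancel
      (by positivity) hden
    refine ENNReal.eq_inv_of_mul_eq_one_left ?_
    rw [← h1]
    ring
  have hq : μ {t : ℝ≥0 | κ ≤ (t : ℝ)}ᶜ < 1 := by
    rw [prob_compl_eq_one_sub (measurableSet_level κ)]
    exact ENNReal.sub_lt_self ENNReal.one_ne_top one_ne_zero hocc.ne'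
  -- Testing `M` sites per box makes vacancy as unlikely as desired; `M` depends on `d`, `μ` and `κ`
  -- but not on `l`.
  obtain ⟨M, hM⟩ := ((ENNReal.tendsto_pow_atTop_nhds_zero_of_lt_one hq).eventually
    (gt_mem_nhds hr0)).exists
  refine ⟨M, fun l hl => ⟨fun n => (⋃ k : ℕ, sparseEvent κ M l (k + (n + 1)))ᶜ, fun n =>
    ⟨(MeasurableSet.iUnion fun k => measurableSet_sparseEvent _ _ _ _).compl, ?_, ?_⟩⟩⟩
  · rw [compl_compl]
    calc potentialLaw d μ (⋃ k : ℕ, sparseEvent κ M l (k + (n + 1)))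
        ≤ ∑' k : ℕ, (2⁻¹ : ℝ≥0∞) ^ (k + (n + 1)) := by
          refine (measure_iUnion_le _).trans (ENNReal.tsum_le_tsum fun k => ?_)
          rw [← hNr]
          exact potentialLaw_sparseEvent_le μ κ hl _ hr1 hM.le
      _ = 2 * 2⁻¹ ^ (n + 1) := by
          simp_rw [pow_add _ _ (n + 1)]
          rw [ENNReal.tsum_mul_right, ENNReal.tsum_geometric, ENNReal.one_sub_inv_two, inv_inv]
      _ ≤ 2 * 2⁻¹ ^ n := by
          gcongr 2 * ?_
          exact pow_le_pow_right_of_le_one' (by norm_num) n.le_succ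
      _ = ENNReal.ofReal (2 * Real.exp (-Real.log 2 * n)) := by
          rw [ENNReal.ofReal_mul zero_le_two, mul_comm (-Real.log 2), Real.exp_nat_mul,
            Real.exp_neg, Real.exp_log zero_lt_two, ENNReal.ofReal_pow (by positivity),
            ENNReal.ofReal_inv_of_pos zero_lt_two]
          simp
  · intro ω hω D hD Y hYD hY
    by_contra! hcon
    refine hω (Set.mem_iUnion.2 ⟨D.card - (n + 1), ?_⟩)
    rw [Nat.sub_add_cancel hcon.1]
    exact Set.mem_biUnion hD.mem_animals (Set.mem_biUnion
      (Finset.mem_coe.2 (Finset.mem_filter.2 ⟨Finset.mem_powerset.2 hYD, hcon.2⟩)) hY)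

end

section

variable {d : ℕ}

/-! ### Coarse graining -/

/-- The sites at sup-distance at least `3l/4` from `a`. -/
def exitSet (l : ℕ) (a : Lattice d) : Set (Lattice d) := {z | 3 * (l : ℝ) / 4 ≤ ‖z - a‖}

theorem notMem_exitSet_iff {l : ℕ} (hl : 0 < l) {a z : Lattice d} :
    z ∉ exitSet l a ↔ ∀ i, 4 * |z i - a i| < 3 * (l : ℤ) := by
  have h0 : (0 : ℝ) < 3 * (l : ℝ) / 4 := by positivity
  rw [exitSet, Set.mem_ofPred_eq, not_le, pi_norm_lt_iff h0]
  refine forall_congr' fun i => ?_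
  rw [Pi.sub_apply, Int.norm_eq_abs, lt_div_iff₀ (by norm_num), mul_comm]
  exact_mod_cast Iff.rfl

theorem self_notMem_exitSet {l : ℕ} (hl : 0 < l) (a : Lattice d) : a ∉ exitSet l a := by
  rw [notMem_exitSet_iff hl]
  intro i
  simpa using hl

/-- The index of the box of side `l` containing `z`. -/
def boxIndex (l : ℕ) (z : Lattice d) : Lattice d := fun i => (2 * z i + l) / (2 * l)

theorem two_mul_abs_sub_boxIndex_le {l : ℕ} (hl : 0 < l) (z : Lattice d) (i : Fin d) :
    2 * |z i - l * boxIndex l z i| ≤ l := by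
  have h1 := Int.mul_ediv_add_emod (2 * z i + l) (2 * l)
  have h2 := Int.emod_nonneg (2 * z i + l) (show (2 * (l : ℤ)) ≠ 0 by omega)
  have h3 := Int.emod_lt_of_pos (2 * z i + l) (show 0 < (2 * (l : ℤ)) by omega)
  have h4 : 2 * (l : ℤ) * boxIndex l z i + (2 * z i + l) % (2 * l) = 2 * z i + l := h1
  have h5 : 2 * (z i - l * boxIndex l z i) = (2 * z i + l) % (2 * l) - l := by linarith
  rw [← abs_two (α := ℤ), ← abs_mul, abs_le]
  constructor <;> linarith

theorem boxIndex_zero {l : ℕ} (hl : 0 < l) : boxIndex l (0 : Lattice d) = 0 := by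
  funext i
  simp only [boxIndex, Pi.zero_apply, mul_zero, zero_add]
  exact Int.ediv_eq_zero_of_lt (by omega) (by omega)

/-- Each cut point is within `l/2` of its box centre and the crossing overshoots `3l/4` by at most
one step, so the centres differ by less than `7l/4 + 1 < 3l`. Consecutive boxes thus extend an
animal. -/
theorem boxIndex_sub_mem_shortVectors {l : ℕ} (hl : 4 ≤ l) {a z s : Lattice d}
    (hz : z ∉ exitSet l a) (hs : ∀ i, |s i| ≤ 1) :
    boxIndex l (z + s) - boxIndex l a ∈ shortVectors d := by
  rw [mem_shortVectors]
  intro i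
  have hl0 : 0 < l := by omega
  have h1 := two_mul_abs_sub_boxIndex_le hl0 (z + s) i
  have h2 := two_mul_abs_sub_boxIndex_le hl0 a i
  have h3 := (notMem_exitSet_iff hl0).1 hz i
  have h4 := hs i
  have h5 : (l : ℤ) * |boxIndex l (z + s) i - boxIndex l a i| < l * 3 := by
    rw [← abs_of_pos (show (0 : ℤ) < l by omega), ← abs_mul, abs_of_pos (show (0 : ℤ) < l by omega),
      mul_sub]
    simp only [Pi.add_apply] at h1
    rw [abs_lt]
    have h6 := abs_sub_le_iff.1 (le_refl |z i + s i - l * boxIndex l (z + s) i|)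
    have h7 := abs_sub_le_iff.1 (le_refl |a i - l * boxIndex l a i|)
    have h8 := abs_sub_le_iff.1 (le_refl |z i - a i|)
    have h9 := abs_le.1 h4
    constructor <;> omega
  have := lt_of_mul_lt_mul_left h5 (by omega)
  simp only [Pi.sub_apply]
  omega

/-- Every site of `B` is within distance `2l` of the centre of a box of `D`. -/
def IsCover (l : ℕ) (D B : Finset (Lattice d)) : Prop :=
  ∀ b ∈ B, ∃ y ∈ D, ∀ i, |b i - l * y i| ≤ 2 * l

theorem IsCover.card_le {l : ℕ} {D B : Finset (Lattice d)} (h : IsCover l D B) :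
    B.card ≤ D.card * (4 * l + 1) ^ d := by
  have hsub : B ⊆ D.biUnion fun y =>
      Finset.Icc (fun i => l * y i - 2 * l) (fun i => l * y i + 2 * l) := by
    intro b hb
    obtain ⟨y, hy, hby⟩ := h b hb
    refine Finset.mem_biUnion.2 ⟨y, hy, Finset.mem_Icc.2 ⟨fun i => ?_, fun i => ?_⟩⟩
    · have := (abs_le.1 (hby i)).1
      linarith
    · have := (abs_le.1 (hby i)).2
      linarith
  refine (Finset.card_le_card hsub).trans (Finset.card_biUnion_le_card_mul _ _ _ fun y _ => ?_)
  rw [Pi.card_Icc]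
  simp only [Int.card_Icc]
  rw [Finset.prod_congr rfl (g := fun _ => 4 * l + 1) fun i _ => by omega]
  simp

theorem IsCover.insert {l : ℕ} (hl : 0 < l) {D B : Finset (Lattice d)} (h : IsCover l D B)
    {a z : Lattice d} (ha : boxIndex l a ∈ D) (hz : z ∉ exitSet l a) :
    IsCover l D (insert z B) := by
  intro b hb
  rcases Finset.mem_insert.1 hb with rfl | hb
  · refine ⟨boxIndex l a, ha, fun i => ?_⟩
    have h1 := two_mul_abs_sub_boxIndex_le hl a i
    have h2 := (notMem_exitSet_iff hl).1 hz i
    have h3 := abs_sub_le (b i) (a i) (l * boxIndex l a i)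
    omega
  · exact h b hb

theorem IsCover.mono {l : ℕ} {D D' B : Finset (Lattice d)} (h : IsCover l D B) (hD : D ⊆ D') :
    IsCover l D' B := fun b hb => (h b hb).imp fun _ hy => ⟨hD hy.1, hy.2⟩

/-! ### The supermartingale estimate -/

variable [NeZero d]

open Classical in
/-- The boxes of `D` that are occupied. -/
noncomputable def occupiedBoxes (κ : ℝ) (M l : ℕ) (ω : Potential d) (D : Finset (Lattice d)) :
    Finset (Lattice d) := D.filter (LineOccupied κ M l ω)

theorem card_occupiedBoxes_insert_le (κ : ℝ) (M l : ℕ) (ω : Potential d) (D : Finset (Lattice d))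
    (y : Lattice d) :
    (occupiedBoxes κ M l ω (insert y D)).card ≤ (occupiedBoxes κ M l ω D).card + 1 := by
  classical
  rw [occupiedBoxes, Finset.filter_insert]
  split_ifs
  · exact Finset.card_insert_le _ _
  · exact Nat.le_succ _

theorem occupiedBoxes_insert_of_not {κ : ℝ} {M l : ℕ} {ω : Potential d} {D : Finset (Lattice d)}
    {y : Lattice d} (hy : ¬ LineOccupied κ M l ω y) :
    occupiedBoxes κ M l ω (insert y D) = occupiedBoxes κ M l ω D := by
  classical
  rw [occupiedBoxes, Finset.filter_insert, if_neg hy, occupiedBoxes]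

/-- Here `a` is the last cut point, `z` the current site and `D` the boxes found so far. Inside a
crossing, `u` reproduces itself under one killed step. At its end `u = 1`, and the available `1 + β`
pays for a new occupied box by `hβ`. The summand `1` covers paths that reach `x` in the middle of a
crossing, before its killing is earned. -/
theorem truncMean_le_of_supermartingale {κ : ℝ} {M l : ℕ} (hl : 4 ≤ l) {ω : Potential d}
    {X g β K : ℝ≥0∞} {h : Finset (Lattice d) → ℝ≥0∞} (x : Lattice d)
    (hX : ∀ N a, LineOccupied κ M l ω (boxIndex l a) → truncMean ω (exitSet l a) 1 N ∅ a ≤ X)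
    (hg : 1 ≤ g) (hβ : g * (1 + β * X) ≤ 1 + β)
    (hh : ∀ D B, IsAnimal D → IsCover l D B → h B ≤ K * g ^ (occupiedBoxes κ M l ω D).card)
    (N : ℕ) (D B : Finset (Lattice d)) (a z : Lattice d) (hD : IsAnimal D)
    (ha : boxIndex l a ∈ D) (hz : z ∉ exitSet l a) (hB : IsCover l D B) :
    truncMean ω {x} h N B z ≤ K * (g ^ (occupiedBoxes κ M l ω D).card *
      (1 + β * truncMean ω (exitSet l a) 1 N ∅ z)) := by
  have hterm : ∀ {D B : Finset (Lattice d)} (t : ℝ≥0∞), IsAnimal D → IsCover l D B →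
      h B ≤ K * (g ^ (occupiedBoxes κ M l ω D).card * (1 + t)) := fun t hD hB =>
    (hh _ _ hD hB).trans (by gcongr; exact le_mul_of_one_le_right' le_self_add)
  induction N generalizing D B a z with
  | zero =>
    by_cases hzx : z ∈ ({x} : Set (Lattice d))
    · rw [truncMean_of_mem hzx]
      exact hterm _ hD hB
    · simp [truncMean, Set.mem_singleton_iff.not.1 hzx]
  | succ N ih =>
    by_cases hzx : z ∈ ({x} : Set (Lattice d))
    · rw [truncMean_of_mem hzx]
      exact hterm _ hD hB
    have hB' := hB.insert (by omega) ha hz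
    rw [truncMean_succ_of_notMem hzx, truncMean_succ_of_notMem hz]
    set G := g ^ (occupiedBoxes κ M l ω D).card with hG
    have hstep : ∀ᵐ s ∂stepLaw d, truncMean ω {x} h N (insert z B) (z + s) ≤
        K * (G * (1 + β * truncMean ω (exitSet l a) 1 N (insert z ∅) (z + s))) := by
      filter_upwards [ae_stepLaw_abs_le_one] with s hs
      rw [truncMean_one_congr N (insert z ∅) ∅]
      by_cases hex : z + s ∈ exitSet l a
      -- The crossing ends here: `z + s` becomes the new cut point and its box joins the animal.
      · have hD' : IsAnimal (insert (boxIndex l (z + s)) D) := by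
          have := hD.insert ha (boxIndex_sub_mem_shortVectors hl hz hs)
          rwa [add_sub_cancel] at this
        refine (ih (insert (boxIndex l (z + s)) D) (insert z B) (z + s) (z + s) hD'
          (Finset.mem_insert_self _ _) (self_notMem_exitSet (by omega) _)
          (hB'.mono (Finset.subset_insert _ _))).trans ?_
        rw [truncMean_of_mem hex]
        simp only [Pi.one_apply, mul_one]
        gcongr K * ?_
        by_cases hocc : LineOccupied κ M l ω (boxIndex l (z + s))
        · calc _ ≤ g ^ ((occupiedBoxes κ M l ω D).card + 1) * (1 + β * X) := by
                gcongr
                · exact card_occupiedBoxes_insert_le κ M l ω D _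
                · exact hX N _ hocc
            _ = G * (g * (1 + β * X)) := by rw [hG]; ring
            _ ≤ G * (1 + β) := by gcongr
        -- A vacant box leaves the exponent unchanged, so the trivial bound `u ≤ 1` for the next
        -- crossing suffices.
        · rw [occupiedBoxes_insert_of_not hocc]
          gcongr
          exact mul_le_of_le_one_right' (truncMean_one_le_one _ _ _)
      · exact ih D (insert z B) a (z + s) hD ha hex hB'
    calc _ ≤ ENNReal.ofReal (Real.exp (-(ω z : ℝ))) * ∫⁻ s,
          K * (G * (1 + β * truncMean ω (exitSet l a) 1 N (insert z ∅) (z + s))) ∂stepLaw d := by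
          gcongr _ * ?_
          exact lintegral_mono_ae hstep
      _ = K * (G * (ENNReal.ofReal (Real.exp (-(ω z : ℝ))) * 1 +
          β * (ENNReal.ofReal (Real.exp (-(ω z : ℝ))) *
            ∫⁻ s, truncMean ω (exitSet l a) 1 N (insert z ∅) (z + s) ∂stepLaw d))) := by
          rw [lintegral_const_mul _ .of_discrete, lintegral_const_mul _ .of_discrete,
            lintegral_add_left measurable_const, lintegral_const_mul _ .of_discrete]
          simp only [lintegral_one, measure_univ, mul_one]
          ring
      -- The killing at `z` is dropped from the summand `1` and retained in `u`.
      _ ≤ _ := by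
          gcongr
          rw [mul_one]
          exact ofReal_exp_neg_le_one _

end

section

variable {d : ℕ}

/-! ### The constant `χ` -/

theorem crossTime_pathOfSteps {l : ℕ} (hl : 0 < l) (z : Lattice d) (ξ : ℕ → Lattice d) :
    crossTime l (pathOfSteps z ξ) = firstTime fun k => pathOfSteps z ξ k ∈ exitSet l z := by
  rw [crossTime_eq_firstTime]
  congr 1
  funext k
  rw [pathOfSteps_zero, eq_iff_iff]
  refine ⟨fun h => h.2, fun h => ⟨Nat.pos_of_ne_zero ?_, h⟩⟩
  rintro rfl
  rw [pathOfSteps_zero] at h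
  exact self_notMem_exitSet hl z h

/-- Shifting the potential moves any box to the origin, where `χ` is defined; `χ` is a supremum over
all potentials, so the shift is harmless. -/
theorem killing_crossTime_translate (ω : Potential d) (l : ℕ) (z v : Lattice d)
    (ξ : ℕ → Lattice d) :
    killing (fun u => ω (u + v)) (crossTime l (pathOfSteps z ξ)) (pathOfSteps z ξ) =
      killing ω (crossTime l (pathOfSteps (z + v) ξ)) (pathOfSteps (z + v) ξ) := by
  simp only [killing, crossTime_eq_firstTime, pathOfSteps_add, add_sub_add_right_eq_sub]

theorem norm_le_half_iff {l : ℕ} {z : Lattice d} :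
    ‖z‖ ≤ (l : ℝ) / 2 ↔ ∀ i, 2 * |z i| ≤ l := by
  rw [pi_norm_le_iff_of_nonneg (by positivity)]
  refine forall_congr' fun i => ?_
  rw [Int.norm_eq_abs, le_div_iff₀ (by norm_num), mul_comm]
  exact_mod_cast Iff.rfl

theorem zero_mem_innerCube {l : ℕ} (hl : 0 < l) : (0 : Lattice d) ∈ innerCube d l := by
  have : (0 : ℝ) < l := by exact_mod_cast hl
  intro i
  constructor <;> simp only [Pi.zero_apply, Int.cast_zero] <;> linarith

variable [NeZero d]

theorem integrable_killing_crossTime (ω : Potential d) (l : ℕ) (z : Lattice d) :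
    Integrable (fun S => killing ω (crossTime l S) S) (walkLaw z) := by
  refine Integrable.of_bound (measurable_killing_crossTime ω l).aestronglyMeasurable 1
    (.of_forall fun S => ?_)
  rw [Real.norm_of_nonneg (killing_nonneg _ _ _)]
  exact killing_le_one _ _ _

theorem integral_killing_le_chi {κ : ℝ} {l : ℕ} {z : Lattice d} {ω : Potential d}
    (hz : ‖z‖ ≤ (l : ℝ) / 2) (hω : Occupied κ ω (innerCube d l)) :
    ∫ S, killing ω (crossTime l S) S ∂walkLaw z ≤ chi d κ l := by
  refine le_csSup ⟨1, ?_⟩ ⟨z, ω, hz, hω, rfl⟩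
  rintro _ ⟨z, ω, -, -, rfl⟩
  calc ∫ S, killing ω (crossTime l S) S ∂walkLaw z ≤ ∫ _S, 1 ∂walkLaw z :=
        integral_mono (integrable_killing_crossTime ω l z) (integrable_const _)
          fun S => killing_le_one _ _ _
    _ = 1 := by simp

/-- The mean weight up to leaving an occupied box is at most `χ`. -/
theorem truncMean_le_chi {κ : ℝ} {M l : ℕ} (hl : 0 < l) (hM : 8 * M ≤ l) {ω : Potential d}
    (N : ℕ) (a : Lattice d) (ha : LineOccupied κ M l ω (boxIndex l a)) :
    truncMean ω (exitSet l a) 1 N ∅ a ≤ ENNReal.ofReal (chi d κ l) := by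
  set v : Lattice d := (l : ℤ) • boxIndex l a with hv
  have hz : ‖a - v‖ ≤ (l : ℝ) / 2 :=
    norm_le_half_iff.2 fun i => by simpa [hv] using two_mul_abs_sub_boxIndex_le hl a i
  have hω : Occupied κ (fun u => ω (u + v)) (innerCube d l) := by
    obtain ⟨j, hj, hκ⟩ := ha
    refine ⟨Pi.single 0 (j : ℤ), fun i => ?_, ?_⟩
    swap
    · rwa [boxSite, add_comm] at hκ
    have hjl : 8 * (j : ℝ) < l := by exact_mod_cast (by omega : 8 * j < l)
    have hj0 : (0 : ℝ) ≤ j := j.cast_nonneg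
    by_cases hi : i = 0
    · subst hi
      simp only [Pi.single_eq_same, Int.cast_natCast]
      constructor <;> linarith
    · simp only [Pi.single_eq_of_ne hi, Int.cast_zero]
      constructor <;> linarith
  refine (truncMean_one_le N ∅ a).trans ?_
  calc ∫⁻ ξ, ENNReal.ofReal (killing ω (firstTime fun k => pathOfSteps a ξ k ∈ exitSet l a)
          (pathOfSteps a ξ)) ∂stepsLaw d
      = ∫⁻ S, ENNReal.ofReal (killing (fun u => ω (u + v)) (crossTime l S) S)
          ∂walkLaw (a - v) := by
        rw [walkLaw, lintegral_map (measurable_killing_crossTime _ l).ennreal_ofReal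
          (measurable_pathOfSteps _), stepsLaw]
        refine lintegral_congr fun ξ => ?_
        rw [killing_crossTime_translate, sub_add_cancel, crossTime_pathOfSteps hl]
    _ = ENNReal.ofReal (∫ S, killing (fun u => ω (u + v)) (crossTime l S) S ∂walkLaw (a - v)) :=
        (ofReal_integral_eq_lintegral_ofReal (integrable_killing_crossTime _ l _)
          (.of_forall fun S => killing_nonneg _ _ _)).symm
    _ ≤ ENNReal.ofReal (chi d κ l) := ENNReal.ofReal_le_ofReal (integral_killing_le_chi hz hω)

theorem chi_pos {κ : ℝ} {l : ℕ} (hl : 0 < l) : 0 < chi d κ l := by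
  have hω : Occupied κ (fun _ => κ.toNNReal) (innerCube d l) :=
    ⟨0, zero_mem_innerCube hl, Real.le_coe_toNNReal κ⟩
  refine lt_of_lt_of_le ?_ (integral_killing_le_chi (z := (0 : Lattice d))
    (by rw [norm_zero]; positivity) hω)
  have h := integrable_killing_crossTime (fun _ : Lattice d => κ.toNNReal) l 0
  unfold killing at h ⊢
  exact integral_exp_pos h

/-- A nearest-neighbour path that reaches `w` from `z` without leaving the cube around `a`, and then
follows the first coordinate direction. -/
theorem exists_steps {l : ℕ} (hl : 0 < l) {a w : Lattice d} (hw : w ∉ exitSet l a) (n : ℕ)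
    (z : Lattice d) (hz : z ∉ exitSet l a) (hn : ∑ i, |w i - z i| = n) :
    ∃ s : ℕ → Lattice d, (∀ k, ∃ (i : Fin d) (ε : ℤˣ), s k = Pi.single i (ε : ℤ)) ∧
      (∀ k ≤ n, pathOfSteps z s k ∉ exitSet l a) ∧
      ∀ k, pathOfSteps z s (n + k) = w + Pi.single 0 (k : ℤ) := by
  induction n generalizing z with
  | zero =>
    have hwz : z = w := by
      funext i
      have h := (Finset.sum_eq_zero_iff_of_nonneg fun i _ => abs_nonneg (w i - z i)).1
        (by simpa using hn) i (Finset.mem_univ i)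
      linarith [abs_eq_zero.1 h]
    subst hwz
    refine ⟨fun _ => Pi.single 0 1, fun _ => ⟨0, 1, by simp⟩, fun k hk => ?_, fun k => ?_⟩
    · rw [Nat.le_zero.1 hk, pathOfSteps_zero]
      exact hz
    · simp only [pathOfSteps, zero_add, Finset.sum_const, Finset.card_range, add_right_inj]
      rw [← Pi.single_smul]
      simp
  | succ n ih =>
    obtain ⟨i, hi⟩ : ∃ i, w i ≠ z i := by
      by_contra! h
      simp [h] at hn
      omega
    obtain ⟨ε, hε⟩ : ∃ ε : ℤˣ, |w i - (z i + ε)| = |w i - z i| - 1 ∧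
        |z i + ε - a i| ≤ max |z i - a i| |w i - a i| := by
      rcases lt_or_gt_of_ne hi with h | h
      · refine ⟨-1, ?_, ?_⟩
        · simp only [Units.val_neg, Units.val_one]
          rw [abs_of_nonpos (by omega), abs_of_nonpos (by omega)]
          ring
        · simp only [Units.val_neg, Units.val_one]
          rw [max_comm]
          exact abs_le_max_abs_abs (by omega) (by omega)
      · refine ⟨1, ?_, ?_⟩
        · simp only [Units.val_one]
          rw [abs_of_nonneg (by omega), abs_of_nonneg (by omega)]
          ring
        · simp only [Units.val_one]
          exact abs_le_max_abs_abs (by omega) (by omega)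
    have hz' : z + Pi.single i (ε : ℤ) ∉ exitSet l a := by
      rw [notMem_exitSet_iff hl] at hz hw ⊢
      intro j
      by_cases hj : j = i
      · subst hj
        simp only [Pi.add_apply, Pi.single_eq_same]
        have h1 := hz j
        have h2 := hw j
        rcases le_max_iff.1 hε.2 with h | h <;> linarith
      · simpa [hj] using hz j
    have hn' : ∑ j, |w j - (z + Pi.single i (ε : ℤ) : Lattice d) j| = n := by
      rw [← Finset.add_sum_erase _ _ (Finset.mem_univ i)] at hn ⊢
      rw [Finset.sum_congr rfl (g := fun j => |w j - z j|)]
      · simp only [Pi.add_apply, Pi.single_eq_same, hε.1]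
        push_cast at hn
        linarith
      · intro j hj
        simp [Finset.ne_of_mem_erase hj]
    obtain ⟨s, h1, h2, h3⟩ := ih _ hz' hn'
    refine ⟨consSeq (Pi.single i (ε : ℤ), s), fun k => ?_, fun k hk => ?_, fun k => ?_⟩
    · cases k with
      | zero => exact ⟨i, ε, rfl⟩
      | succ k => exact h1 k
    · cases k with
      | zero => rwa [pathOfSteps_zero]
      | succ k =>
        rw [pathOfSteps_consSeq_succ]
        exact h2 k (by omega)
    · rw [add_right_comm, pathOfSteps_consSeq_succ]
      exact h3 k

theorem stepsLaw_cylinder_ge {s : ℕ → Lattice d}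
    (hs : ∀ k, ∃ (i : Fin d) (ε : ℤˣ), s k = Pi.single i (ε : ℤ)) (R : ℕ) :
    ((2 * d : ℕ) : ℝ≥0∞)⁻¹ ^ R ≤
      stepsLaw d (Set.pi (Finset.range R : Set ℕ) fun k => {s k}) := by
  rw [stepsLaw, Measure.infinitePi_pi _ fun _ _ => measurableSet_singleton _]
  refine le_trans (by simp) (Finset.prod_le_prod' (f := fun _ => ((2 * d : ℕ) : ℝ≥0∞)⁻¹)
    fun k _ => ?_)
  obtain ⟨i, ε, h⟩ := hs k
  rw [h]
  exact inv_two_mul_le_stepLaw i ε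

/-- An occupied site `w` of the inner cube is within `l/2 + l/8 < 3l/4` of `z`. A path going to `w`
inside the exit cube and then straight out has at most `d*l + 2*l` steps, hence probability bounded
below uniformly in `z` and `ω`, and on it the weight is at most `exp(-κ)`. -/
theorem integral_killing_le {κ : ℝ} (hκ : 0 < κ) {l : ℕ} (hl : 0 < l) {z : Lattice d}
    {ω : Potential d} (hz : ‖z‖ ≤ (l : ℝ) / 2) (hω : Occupied κ ω (innerCube d l)) :
    ∫ S, killing ω (crossTime l S) S ∂walkLaw z ≤
      1 - (1 - Real.exp (-κ)) * ((2 * d : ℕ) : ℝ)⁻¹ ^ (d * l + 2 * l) := by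
  obtain ⟨w, hw, hκw⟩ := hω
  have hw' : ∀ i, 8 * |w i| < (l : ℤ) := fun i => by
    have h : 8 * |(w i : ℝ)| < l := by
      have := abs_lt.2 (show -((l : ℝ) / 8) < w i ∧ (w i : ℝ) < l / 8 by
        rw [← neg_div]; exact hw i)
      linarith
    exact_mod_cast h
  have hz' := norm_le_half_iff.1 hz
  have hwz : w ∉ exitSet l z := (notMem_exitSet_iff hl).2 fun i => by
    have h1 := abs_sub (w i) (z i)
    have h2 := hw' i
    have h3 := hz' i
    omega
  obtain ⟨n, hn⟩ : ∃ n : ℕ, ∑ i, |w i - z i| = n :=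
    Int.eq_ofNat_of_zero_le (Finset.sum_nonneg fun i _ => abs_nonneg _)
  have hnl : n ≤ d * l := by
    have : ∑ i, |w i - z i| ≤ ∑ _i : Fin d, (l : ℤ) := Finset.sum_le_sum fun i _ => by
      have h1 := abs_sub (w i) (z i)
      have h2 := hw' i
      have h3 := hz' i
      omega
    rw [hn] at this
    simp only [Finset.sum_const, Finset.card_univ, Fintype.card_fin, nsmul_eq_mul] at this
    exact_mod_cast this
  obtain ⟨s, hs, hstay, hpath⟩ := exists_steps hl hwz n z (self_notMem_exitSet hl z) hn
  have hexit : pathOfSteps z s (n + 2 * l) ∈ exitSet l z := by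
    by_contra h
    rw [hpath, notMem_exitSet_iff hl] at h
    have h0 := h 0
    have h1 := (notMem_exitSet_iff hl).1 hwz 0
    simp only [Pi.add_apply, Pi.single_eq_same] at h0
    push_cast at h0
    have h2 := le_abs_self (w 0 + 2 * (l : ℤ) - z 0)
    have h3 := neg_abs_le (w 0 - z 0)
    omega
  set R := d * l + 2 * l with hR
  set C : Set (ℕ → Lattice d) := Set.pi (Finset.range R : Set ℕ) fun k => {s k} with hC
  have hCm : MeasurableSet C :=
    .pi (Finset.countable_toSet _) fun _ _ => measurableSet_singleton _
  have hkill : ∀ ξ ∈ C, killing ω (crossTime l (pathOfSteps z ξ)) (pathOfSteps z ξ) ≤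
      Real.exp (-κ) := by
    intro ξ hξ
    have hagree : ∀ k ≤ R, pathOfSteps z ξ k = pathOfSteps z s k := fun k hk => by
      simp only [pathOfSteps]
      congr 1
      refine Finset.sum_congr rfl fun j hj => ?_
      have hjk := Finset.mem_range.1 hj
      exact hξ j (by simpa using by omega)
    -- The exit time `t` of the model path exceeds `n`, the time of its visit to `w`, so the killing
    -- sum includes `ω w`.
    obtain ⟨t, ht, hmin⟩ :=
      exists_first (P := fun k => pathOfSteps z s k ∈ exitSet l z) ⟨n + 2 * l, hexit⟩
    have htle : t ≤ n + 2 * l := not_lt.1 fun h => hmin _ h hexit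
    have hnt : n < t := not_le.1 fun h => hstay t h ht
    rw [crossTime_pathOfSteps hl, firstTime_eq_coe (k := t) (by rwa [hagree t (by omega)])
      fun j hj => by rw [hagree j (by omega)]; exact hmin j hj]
    refine Real.exp_le_exp.2 (neg_le_neg (hκw.trans ?_))
    have hwn : pathOfSteps z ξ n = w := by
      rw [hagree n (by omega)]
      simpa using hpath 0
    rw [← hwn]
    exact Finset.single_le_sum (f := fun k => (ω (pathOfSteps z ξ k) : ℝ))
      (fun _ _ => NNReal.coe_nonneg _) (by simpa using hnt)
  have hP : ((2 * d : ℕ) : ℝ)⁻¹ ^ R ≤ (stepsLaw d).real C := by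
    have h := ENNReal.toReal_mono (measure_ne_top _ _) (stepsLaw_cylinder_ge hs R)
    rwa [ENNReal.toReal_pow, ENNReal.toReal_inv, ENNReal.toReal_natCast] at h
  have hint : Integrable (fun ξ =>
      killing ω (crossTime l (pathOfSteps z ξ)) (pathOfSteps z ξ)) (stepsLaw d) :=
    (integrable_map_measure (measurable_killing_crossTime ω l).aestronglyMeasurable
      (measurable_pathOfSteps z).aemeasurable).1 (integrable_killing_crossTime ω l z)
  have hind : Integrable (C.indicator fun _ => 1 - Real.exp (-κ)) (stepsLaw d) :=
    (integrable_const _).indicator hCm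
  calc ∫ S, killing ω (crossTime l S) S ∂walkLaw z
      = ∫ ξ, killing ω (crossTime l (pathOfSteps z ξ)) (pathOfSteps z ξ) ∂stepsLaw d :=
        integral_map (measurable_pathOfSteps z).aemeasurable
          (measurable_killing_crossTime ω l).aestronglyMeasurable
    _ ≤ ∫ ξ, (1 - C.indicator (fun _ => 1 - Real.exp (-κ)) ξ) ∂stepsLaw d := by
        refine integral_mono hint ((integrable_const _).sub hind) fun ξ => ?_
        by_cases hξ : ξ ∈ C
        · simpa [hξ] using hkill ξ hξ
        · simpa [hξ] using killing_le_one _ _ _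
    _ = 1 - (1 - Real.exp (-κ)) * (stepsLaw d).real C := by
        rw [integral_sub (integrable_const _) hind, integral_indicator_const _ hCm]
        simp [mul_comm]
    _ ≤ _ := by
        have : Real.exp (-κ) ≤ 1 := Real.exp_le_one_iff.2 (by linarith)
        gcongr

theorem chi_lt_one {κ : ℝ} (hκ : 0 < κ) {l : ℕ} (hl : 0 < l) : chi d κ l < 1 := by
  have hd : 0 < d := Nat.pos_of_ne_zero (NeZero.ne d)
  have hδ : 0 < (1 - Real.exp (-κ)) * ((2 * d : ℕ) : ℝ)⁻¹ ^ (d * l + 2 * l) := by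
    have : Real.exp (-κ) < 1 := Real.exp_lt_one_iff.2 (by linarith)
    have h2 : (0 : ℝ) < ((2 * d : ℕ) : ℝ) := by exact_mod_cast (by omega : 0 < 2 * d)
    have h3 : 0 < 1 - Real.exp (-κ) := by linarith
    positivity
  refine lt_of_le_of_lt (csSup_le ?_ ?_) (sub_lt_self 1 hδ)
  · exact ⟨_, 0, fun _ => κ.toNNReal, by rw [norm_zero]; positivity, ⟨0, zero_mem_innerCube hl,
      Real.le_coe_toNNReal κ⟩, rfl⟩
  · rintro _ ⟨z, ω, hz, hω, rfl⟩
    exact integral_killing_le hκ hl hz hω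

end

section

variable {d : ℕ}

/-! ### The exponential moment of the range -/

theorem hitWeight_nonneg (ω : Potential d) (x : Lattice d) (S : Path d) : 0 ≤ hitWeight ω x S :=
  Set.indicator_nonneg (fun _ _ => killing_nonneg _ _ _) S

theorem rangeBefore_eq_image {x : Lattice d} {S : Path d} {k : ℕ} (hk : hitTime x S = k) :
    rangeBefore x S = ((Finset.range k).image S : Finset (Lattice d)) := by
  ext z
  simp [rangeBefore, hk]

variable [NeZero d]

theorem travel_nonneg (ω : Potential d) (x y : Lattice d) : 0 ≤ travel ω x y :=
  integral_nonneg fun S => hitWeight_nonneg ω y S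

/-- Only an upper bound is needed, so neither measurability of `f` nor positivity of `travel` is
required. -/
theorem lintegral_weightedLaw_le (ω : Potential d) (x : Lattice d) (f : Path d → ℝ≥0∞) :
    ∫⁻ S, f S ∂weightedLaw ω x ≤ ENNReal.ofReal (travel ω 0 x)⁻¹ *
      ∫⁻ ξ, ENNReal.ofReal (hitWeight ω x (pathOfSteps 0 ξ)) * f (pathOfSteps 0 ξ)
        ∂stepsLaw d := by
  refine (lintegral_withDensity_le_lintegral_mul _
    ((measurable_hitWeight ω x).const_mul _).ennreal_ofReal f).trans ?_
  refine (lintegral_map_le _ _).trans (le_of_eq ?_)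
  rw [← lintegral_const_mul' _ _ ENNReal.ofReal_ne_top, stepsLaw]
  refine lintegral_congr fun ξ => ?_
  rw [Pi.mul_apply, ENNReal.ofReal_mul (inv_nonneg.2 (travel_nonneg ω 0 x)), mul_assoc]

theorem lintegral_exp_range_le_of_truncMean_le {ω : Potential d} {x : Lattice d} {c : ℝ}
    {K : ℝ≥0∞}
    (hK : ∀ N, truncMean ω {x} (fun B => ENNReal.ofReal (Real.exp (c * B.card))) N ∅ 0 ≤ K) :
    ∫⁻ ξ, ENNReal.ofReal (hitWeight ω x (pathOfSteps 0 ξ)) *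
      ENNReal.ofReal (Real.exp (c * ((rangeBefore x (pathOfSteps 0 ξ)).ncard : ℝ)))
        ∂stepsLaw d ≤ K := by
  refine lintegral_le_of_truncMean_le hK (fun ξ k hk hj => ?_) fun ξ hj => ?_
  · have ht : hitTime x (pathOfSteps 0 ξ) = k := firstTime_eq_coe hk hj
    have hmem : pathOfSteps 0 ξ ∈ {S : Path d | hitTime x S < ⊤} := by
      rw [Set.mem_ofPred_eq, ht]
      exact ENat.natCast_lt_top k
    rw [rangeBefore_eq_image ht, Set.ncard_coe_finset, mul_comm, hitWeight,
      Set.indicator_of_mem hmem, ht]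
  · have hmem : pathOfSteps 0 ξ ∉ {S : Path d | hitTime x S < ⊤} := by
      have ht : hitTime x (pathOfSteps 0 ξ) = ⊤ := firstTime_eq_top hj
      simp [ht]
    rw [hitWeight, Set.indicator_of_notMem hmem, ENNReal.ofReal_zero, zero_mul]

/-- The hypothesis is applied to the set of all vacant boxes of `D`. -/
theorem card_le_add_two_mul_card_occupiedBoxes {κ : ℝ} {M l n : ℕ} {ω : Potential d}
    {D : Finset (Lattice d)}
    (h : ∀ Y ⊆ D, (∀ y ∈ Y, ¬ LineOccupied κ M l ω y) → D.card ≤ n ∨ 2 * Y.card < D.card) :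
    D.card ≤ n + 2 * (occupiedBoxes κ M l ω D).card := by
  classical
  have hcard : (occupiedBoxes κ M l ω D).card +
      (D.filter fun y => ¬ LineOccupied κ M l ω y).card = D.card := by
    rw [occupiedBoxes]
    convert Finset.card_filter_add_card_filter_not (s := D) (LineOccupied κ M l ω)
  rcases h (D.filter fun y => ¬ LineOccupied κ M l ω y) (Finset.filter_subset _ _)
    (fun y hy => (Finset.mem_filter.1 hy).2) with h | h <;> omega

/-- The exponential moment of the range, on the event that large animals contain mostly occupied
boxes. -/
theorem lintegral_exp_range_le {κ χ c G β : ℝ} {M l n : ℕ} (hl : 4 ≤ l) {ω : Potential d}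
    (x : Lattice d) (hχ : 0 < χ) (hc : 0 ≤ c) (hG : 1 ≤ G) (hβ : 0 ≤ β)
    (hGβ : G * (1 + β * χ) ≤ 1 + β)
    (hcχ : Real.exp (c * (4 * l + 1) ^ d) ≤ χ⁻¹) (hcG : Real.exp (2 * (c * (4 * l + 1) ^ d)) = G)
    (hX : ∀ N a, LineOccupied κ M l ω (boxIndex l a) →
      truncMean ω (exitSet l a) 1 N ∅ a ≤ ENNReal.ofReal χ)
    (hω : ∀ D : Finset (Lattice d), IsAnimal D →
      D.card ≤ n + 2 * (occupiedBoxes κ M l ω D).card) :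
    ∫⁻ ξ, ENNReal.ofReal (hitWeight ω x (pathOfSteps 0 ξ)) *
      ENNReal.ofReal (Real.exp (c * ((rangeBefore x (pathOfSteps 0 ξ)).ncard : ℝ)))
        ∂stepsLaw d ≤ ENNReal.ofReal (G * (1 + β) * χ⁻¹ ^ n) := by
  have hG0 : 0 ≤ G := zero_le_one.trans hG
  have h1β : ENNReal.ofReal (1 + β) = 1 + ENNReal.ofReal β := by
    rw [ENNReal.ofReal_add zero_le_one hβ, ENNReal.ofReal_one]
  have hg : 1 ≤ ENNReal.ofReal G := by simpa using hG
  have hGβ' : ENNReal.ofReal G * (1 + ENNReal.ofReal β * ENNReal.ofReal χ) ≤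
      1 + ENNReal.ofReal β := by
    rw [← ENNReal.ofReal_mul hβ, ← ENNReal.ofReal_one,
      ← ENNReal.ofReal_add zero_le_one (by positivity), ← ENNReal.ofReal_mul hG0,
      ← ENNReal.ofReal_add zero_le_one hβ]
    exact ENNReal.ofReal_le_ofReal hGβ
  have hh : ∀ D B : Finset (Lattice d), IsAnimal D → IsCover l D B →
      ENNReal.ofReal (Real.exp (c * B.card)) ≤ ENNReal.ofReal (χ⁻¹ ^ n) *
        ENNReal.ofReal G ^ (occupiedBoxes κ M l ω D).card := by
    intro D B hD hB
    rw [← ENNReal.ofReal_pow hG0, ← ENNReal.ofReal_mul (by positivity)]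
    refine ENNReal.ofReal_le_ofReal ?_
    have hcard : (B.card : ℝ) ≤
        (n + 2 * (occupiedBoxes κ M l ω D).card) * (4 * l + 1) ^ d := by
      exact_mod_cast hB.card_le.trans (Nat.mul_le_mul_right _ (hω D hD))
    calc Real.exp (c * B.card)
        ≤ Real.exp (c * ((n + 2 * (occupiedBoxes κ M l ω D).card) * (4 * l + 1) ^ d)) := by
          gcongr
      -- The `n` free boxes will be charged to `χ⁻¹ ^ n`, the occupied ones to the supermartingale.
      _ = Real.exp (c * (4 * l + 1) ^ d) ^ n * G ^ (occupiedBoxes κ M l ω D).card := by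
          rw [← hcG, ← Real.exp_nat_mul, ← Real.exp_nat_mul, ← Real.exp_add]
          congr 1
          ring
      _ ≤ _ := by gcongr
  refine lintegral_exp_range_le_of_truncMean_le fun N => ?_
  have h00 : boxIndex l (0 : Lattice d) ∈ ({0} : Finset (Lattice d)) := by
    rw [boxIndex_zero (by omega)]
    exact Finset.mem_singleton_self 0
  refine (truncMean_le_of_supermartingale hl x hX hg hGβ' hh N {0} ∅ 0 0 .single h00
    (self_notMem_exitSet (by omega) 0) (by simp [IsCover])).trans ?_
  calc _ ≤ ENNReal.ofReal (χ⁻¹ ^ n) * (ENNReal.ofReal G ^ 1 * (1 + ENNReal.ofReal β * 1)) := by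
        gcongr
        · classical exact (Finset.card_le_card (Finset.filter_subset _ _)).trans (by simp)
        · exact truncMean_one_le_one _ _ _
    _ = _ := by
        rw [pow_one, mul_one, ← h1β, ← ENNReal.ofReal_mul hG0, ← ENNReal.ofReal_mul (by positivity),
          mul_comm]

end

end RandomPotential

/-! ### Choice of the constants -/

theorem proposition4p3 (d : ℕ) [NeZero d] (hd : 2 ≤ d)
    (μ : Measure ℝ≥0) [IsProbabilityMeasure μ]
    (κ : ℝ) (hκ : 0 < κ) (hocc : 0 < μ {t : ℝ≥0 | κ ≤ (t : ℝ)}) :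
    ∃ l₀ : ℕ, ∀ l : ℕ, l₀ ≤ l → Even l →
      RandomPotential.chi d κ l ∈ Set.Ioo (0 : ℝ) 1 ∧
      ∃ C₁ C₂ C₃ C₄ : ℝ, 0 < C₁ ∧ 0 < C₂ ∧ 0 < C₃ ∧ 0 < C₄ ∧
        ∃ A : ℕ → Set (RandomPotential.Potential d),
          ∀ n : ℕ, MeasurableSet (A n) ∧
            RandomPotential.potentialLaw d μ (A n)ᶜ
              ≤ ENNReal.ofReal (C₁ * Real.exp (-C₂ * n)) ∧
            ∀ ω ∈ A n, ∀ x : RandomPotential.Lattice d,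
              ∫⁻ S, ENNReal.ofReal
                  (Real.exp (C₃ * ((RandomPotential.rangeBefore x S).ncard : ℝ)))
                  ∂(RandomPotential.weightedLaw ω x)
                ≤ ENNReal.ofReal (C₄ * ((RandomPotential.chi d κ l)⁻¹) ^ n *
                    (RandomPotential.travel ω 0 x)⁻¹) := by
  open RandomPotential in
  obtain ⟨M, hM⟩ := exists_good_events d μ κ hocc
  -- `8 * M ≤ l` keeps the tested sites in the inner cube; `4 ≤ l` is what the coarse graining
  -- needs.
  refine ⟨8 * M + 4, fun l hl _ => ?_⟩
  have hl0 : 0 < l := by omega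
  have hχ0 : 0 < chi d κ l := chi_pos hl0
  have hχ1 : chi d κ l < 1 := chi_lt_one hκ hl0
  refine ⟨⟨hχ0, hχ1⟩, ?_⟩
  obtain ⟨A, hA⟩ := hM l (by omega)
  set χ := chi d κ l with hχ
  set m : ℝ := (4 * l + 1) ^ d with hm
  have hm0 : 0 < m := by positivity
  have hlog : Real.log χ < 0 := Real.log_neg hχ0 hχ1
  -- Then `exp(c * m) = χ^(-1/4) ≤ χ⁻¹`, while `G = χ^(-1/2)` gives `G * χ = χ^(1/2) < 1`.
  set c : ℝ := -Real.log χ / (4 * m) with hc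
  have hc0 : 0 < c := div_pos (by linarith) (by positivity)
  have hcm : c * m = -Real.log χ / 4 := by
    rw [hc]
    field_simp
  set G := Real.exp (2 * (c * m)) with hG
  have hG1 : 1 ≤ G := Real.one_le_exp (by positivity)
  have hGχ : G * χ < 1 := by
    rw [hG, hcm]
    nth_rewrite 2 [← Real.exp_log hχ0]
    rw [← Real.exp_add, Real.exp_lt_one_iff]
    linarith
  -- The solution of `G * (1 + β * χ) = 1 + β`, nonnegative because `G * χ < 1 ≤ G`.
  set β := (G - 1) / (1 - G * χ) with hβ
  have hβ0 : 0 ≤ β := div_nonneg (by linarith) (by linarith)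
  have hβG : β * (1 - G * χ) = G - 1 := div_mul_cancel₀ _ (by linarith)
  refine ⟨2, Real.log 2, c, G * (1 + β), two_pos, Real.log_pos one_lt_two, hc0, by positivity,
    A, fun n => ⟨(hA n).1, (hA n).2.1, fun ω hω x => ?_⟩⟩
  have key := lintegral_exp_range_le (κ := κ) (χ := χ) (c := c) (G := G) (β := β) (M := M) (n := n)
    (ω := ω) (show 4 ≤ l by omega) x hχ0 hc0.le hG1 hβ0 (by nlinarith) ?_ rfl
    (fun N a ha => truncMean_le_chi hl0 (by omega) N a ha)
    (fun D hD => card_le_add_two_mul_card_occupiedBoxes ((hA n).2.2 ω hω D hD))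
  · refine (lintegral_weightedLaw_le ω x _).trans ?_
    rw [mul_comm _ (travel ω 0 x)⁻¹, ENNReal.ofReal_mul (inv_nonneg.2 (travel_nonneg ω 0 x))]
    gcongr
  · rw [← Real.exp_log hχ0, ← Real.exp_neg]
    refine Real.exp_le_exp.2 ?_
    linarith
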